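/- The center $\mathrm{Z}(\mathbf{C})$ of a category $\mathbf{C}$ is the monoid, under composition, of natural transformations from the identity functor of $\mathbf{C}$ to itself. Let $\mathbf{B}_0$ be a skeleton of the category of all finite groups and homomorphisms. For $G, H$ in $\mathbf{B}_0$ let $\mathbf{B}(G,H)$ be the groupoid whose objects are the homomorphisms $G\to H$ and whose morphisms $\alpha\to\beta$ are the elements $h\in H$ with $h\,\alpha(x)\,h^{-1}=\beta(x)$ for all $x\in G$. Let $\mathrm{Ho}\,\mathbf{B}$ be the category with the same objects as $\mathbf{B}_0$, in which the morphisms $G\to H$ are the connected components of $\mathbf{B}(G,H)$, that is, the conjugacy classes of homomorphisms $G\to H$, with composition induced by that of homomorphisms. Proposition 8.1. The centers $\mathrm{Z}(\mathbf{B}_0)$ and $\mathrm{Z}(\mathrm{Ho}\,\mathbf{B})$ are both isomorphic, as monoids, to the abelian monoid $\{0,1\}$ under multiplication. -/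

import Mathlib

open CategoryTheory

universe u

/-- The multiplicative monoid `{0, 1}`, as a submonoid of `(ℕ, ·)`. -/
def ZeroOne : Submonoid ℕ where
  carrier := {0, 1}
  one_mem' := by simp
  mul_mem' := by
    rintro a b (rfl | rfl) (rfl | rfl) <;> simp

/-- The category `B₀`: a skeleton of the category of all finite groups and homomorphisms. -/
abbrev FinGrpSkel : Type (u + 1) := Skeleton FiniteGrp.{u}

namespace FinGrpSkel

/-- The finite group represented by an object of `B₀`. -/
noncomputable abbrev grp (X : FinGrpSkel.{u}) : FiniteGrp.{u} :=
  (fromSkeleton FiniteGrp.{u}).obj X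

/-- The group homomorphism underlying a morphism of `B₀`. -/
noncomputable def toMonoidHom {X Y : FinGrpSkel.{u}} (f : X ⟶ Y) : X.grp →* Y.grp :=
  ConcreteCategory.hom ((fromSkeleton FiniteGrp.{u}).map f)

theorem toMonoidHom_comp {X Y Z : FinGrpSkel.{u}} (f : X ⟶ Y) (g : Y ⟶ Z) :
    toMonoidHom (f ≫ g) = (toMonoidHom g).comp (toMonoidHom f) := rfl

end FinGrpSkel

/-- Objects of the groupoid `B(G, H)`: the homomorphisms `G → H`. -/
structure HomGroupoid (G H : Type*) [Group G] [Group H] where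
  /-- the underlying homomorphism -/
  hom : G →* H

/-- The groupoid structure: a morphism from `α` to `β` is an element `h` of `H` that
conjugates `α` into `β`, and composition is multiplication in `H`. -/
instance HomGroupoid.groupoid (G H : Type*) [Group G] [Group H] :
    Groupoid (HomGroupoid G H) where
  Hom α β := {h : H // ∀ x : G, h * α.hom x * h⁻¹ = β.hom x}
  id α := ⟨1, fun x => by simp⟩
  comp a b := ⟨b.1 * a.1, fun x => by rw [← b.2 x, ← a.2 x]; group⟩
  inv a := ⟨a.1⁻¹, fun x => by rw [← a.2 x]; group⟩
  id_comp a := Subtype.ext (mul_one a.1)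
  comp_id a := Subtype.ext (one_mul a.1)
  assoc a b c := Subtype.ext (mul_assoc c.1 b.1 a.1).symm
  inv_comp a := Subtype.ext (mul_inv_cancel a.1)
  comp_inv a := Subtype.ext (inv_mul_cancel a.1)

/-- Two morphisms `G → H` of `B₀` are homotopic if they lie in the same connected component
of the groupoid `B(G, H)`, that is, if some element of `H` conjugates one into the other. -/
def homotopyRel : HomRel FinGrpSkel.{u} := fun X Y f g =>
  Nonempty ((⟨FinGrpSkel.toMonoidHom f⟩ : HomGroupoid X.grp Y.grp) ⟶
    ⟨FinGrpSkel.toMonoidHom g⟩)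

/-- Homotopy is a congruence, so that forming the quotient category below identifies
exactly the homotopic morphisms. -/
instance homotopyRel_congruence : Congruence homotopyRel.{u} where
  equivalence :=
    { refl := fun _ => ⟨𝟙 _⟩
      symm := fun ⟨a⟩ => ⟨Groupoid.inv a⟩
      trans := fun ⟨a⟩ ⟨b⟩ => ⟨a ≫ b⟩ }
  comp_left := fun f _ _ ⟨a⟩ => ⟨⟨a.1, fun x => a.2 (FinGrpSkel.toMonoidHom f x)⟩⟩
  comp_right := fun {X Y Z f f'} g ⟨a⟩ => ⟨⟨FinGrpSkel.toMonoidHom g a.1, fun x => by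
    simp only [FinGrpSkel.toMonoidHom_comp, MonoidHom.comp_apply]
    rw [← map_inv, ← map_mul, ← map_mul]
    exact congrArg _ (a.2 x)⟩⟩

/-- The homotopy category `Ho B`: the objects are those of `B₀`, and the morphisms `G ⟶ H` are
the connected components of `B(G, H)`, i.e. conjugacy classes of homomorphisms `G → H`. -/
abbrev HoFinGrp : Type (u + 1) := CategoryTheory.Quotient homotopyRel.{u}

/-!
A natural family of endomorphisms `φ_G` of all finite groups, natural either strictly or up to
conjugation, is decided by its value on the group `Z` of order two, whose only endomorphisms are the
trivial one and the identity. Both centers are treated at once, by letting the conjugating elements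
range over a functorial family of subgroups `N G ≤ G`: `N = ⊥` gives strict naturality, and `N = ⊤`
naturality up to conjugation.

* If `φ_Z` is trivial, then `φ_G` kills every element of order two. Hence it is trivial on symmetric
  groups, which are generated by transpositions, and then on every finite group by Cayley's theorem
  (`NaturalUpTo.eq_one`).
* If `φ_Z` is the identity, then so is `φ_V` for every power `V` of `Z`. Take for `V` the base
  `G → Z` of the wreath product `Z ≀ᵣ G`, on which `G` acts faithfully. Up to conjugation,
  `φ_{Z ≀ᵣ G}` fixes `V` pointwise, so an element `g` of `G` and its image act on `V` in the same way.
  As this action detects the component in `G`, the endomorphism induced on the quotient `G` is the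
  identity up to conjugation; by naturality it is also `φ_G` up to conjugation
  (`NaturalUpTo.exists_conj_eq`).

So each center consists of the identity and of the family of trivial homomorphisms, which are
different because the group of order two exists.
-/

/-! ### Families of endomorphisms natural up to conjugation -/

/-- A family `φ` of endomorphisms of all finite groups that is natural up to conjugation by elements
of the subgroups `N G ≤ G`, which are themselves preserved by all homomorphisms. -/
structure NaturalUpTo (N : ∀ (G : Type u) [Group G] [Finite G], Subgroup G)
    (φ : ∀ (G : Type u) [Group G] [Finite G], G →* G) : Prop where
  map_mem : ∀ {G H : Type u} [Group G] [Finite G] [Group H] [Finite H] (f : G →* H) {x : G},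
    x ∈ N G → f x ∈ N H
  exists_conj : ∀ {G H : Type u} [Group G] [Finite G] [Group H] [Finite H] (f : G →* H),
    ∃ h ∈ N H, ∀ x, h * f (φ G x) * h⁻¹ = φ H (f x)

/-- The group of order two, in an arbitrary universe. -/
abbrev OrderTwo : Type u := ULift.{u} (Multiplicative (ZMod 2))

namespace OrderTwo

/-- The nontrivial element. -/
def gen : OrderTwo.{u} := ⟨Multiplicative.ofAdd 1⟩

theorem eq_one_or_eq_gen (z : OrderTwo.{u}) : z = 1 ∨ z = gen := by
  obtain ⟨z⟩ := z
  have h : ∀ w : Multiplicative (ZMod 2), w = 1 ∨ w = Multiplicative.ofAdd 1 := by decide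
  exact (h z).imp (congrArg ULift.up) (congrArg ULift.up)

theorem gen_ne_one : gen.{u} ≠ 1 := fun h =>
  absurd (congrArg ULift.down h) (by decide : Multiplicative.ofAdd (1 : ZMod 2) ≠ 1)

theorem exists_hom {G : Type*} [Group G] {g : G} (hg : g * g = 1) :
    ∃ f : OrderTwo.{u} →* G, f gen = g := by
  let f : ZMod 2 →+ Additive G := ZMod.lift 2
    ⟨zmultiplesHom (Additive G) (Additive.ofMul g), by
      simpa [two_zsmul] using congrArg Additive.ofMul hg⟩
  refine ⟨(AddMonoidHom.toMultiplicativeLeft f).comp MulEquiv.ulift.toMonoidHom, ?_⟩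
  have h : f 1 = Additive.ofMul g := by
    rw [← Int.cast_one]
    simp only [f, ZMod.lift_coe]
    simp
  exact congrArg Additive.toMul h

theorem endo_eq_one_or_eq_id (f : OrderTwo.{u} →* OrderTwo.{u}) : f = 1 ∨ f = MonoidHom.id _ := by
  rcases eq_one_or_eq_gen (f gen) with h | h
  · left
    ext1 z
    rcases eq_one_or_eq_gen z with rfl | rfl <;> simp [h]
  · right
    ext1 z
    rcases eq_one_or_eq_gen z with rfl | rfl <;> simp [h]

end OrderTwo

namespace RegularWreathProduct

/-- The inclusion of the base group `Q → D` into the wreath product `D ≀ᵣ Q`. -/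
def base (D Q : Type*) [Group D] [Group Q] : (Q → D) →* D ≀ᵣ Q where
  toFun a := ⟨a, 1⟩
  map_one' := rfl
  map_mul' a b := by ext <;> simp

/-- The conjugation action on the base group determines the component in `Q`. -/
theorem right_eq_of_conj_base_eq {D Q : Type*} [Group D] [Nontrivial D] [Group Q] {w : D ≀ᵣ Q}
    {q : Q} (h : ∀ a, w * base D Q a * w⁻¹ = inl q * base D Q a * (inl q)⁻¹) : w.right = q := by
  classical
  obtain ⟨d, hd⟩ := exists_ne (1 : D)
  by_contra hne
  -- Conjugation by `q` moves the function supported at `1` to one supported at `q`.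
  have h1 := congrFun (congrArg RegularWreathProduct.left (h (Pi.mulSingle 1 d))) q
  have hq : w.right⁻¹ * q ≠ 1 := fun h => hne (inv_mul_eq_one.mp h)
  simp [base, hq] at h1
  exact hd h1.symm

end RegularWreathProduct

namespace NaturalUpTo

variable {N : ∀ (G : Type u) [Group G] [Finite G], Subgroup G}
  {φ : ∀ (G : Type u) [Group G] [Finite G], G →* G}

theorem eq_one (hφ : NaturalUpTo N φ) (hZ : φ OrderTwo.{u} = 1) (G : Type u) [Group G] [Finite G] :
    φ G = 1 := by
  classical
  have hinv : ∀ s : Equiv.Perm G, s * s = 1 → φ (Equiv.Perm G) s = 1 := by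
    intro s hs
    obtain ⟨f, rfl⟩ := OrderTwo.exists_hom.{u} hs
    obtain ⟨h, -, hh⟩ := hφ.exists_conj f
    rw [← hh, hZ]
    simp
  have hperm : φ (Equiv.Perm G) = 1 := by
    refine MonoidHom.eq_of_eqOn_dense (Equiv.Perm.closure_isSwap (α := G)) ?_
    rintro s ⟨x, y, -, rfl⟩
    exact hinv _ (Equiv.swap_mul_self x y)
  obtain ⟨h, -, hh⟩ := hφ.exists_conj (MulAction.toPermHom G G)
  ext x
  apply MulAction.toPerm_injective (α := G) (β := G)
  have := hh x
  rw [hperm, MonoidHom.one_apply, conj_eq_one_iff] at this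
  exact this.trans (map_one (MulAction.toPermHom G G)).symm

theorem apply_pi_eq (hφ : NaturalUpTo N φ) (hZ : φ OrderTwo.{u} = MonoidHom.id _) {ι : Type u}
    [Finite ι] (a : ι → OrderTwo.{u}) : φ (ι → OrderTwo.{u}) a = a := by
  funext i
  obtain ⟨h, -, hh⟩ := hφ.exists_conj (Pi.evalMonoidHom (fun _ : ι => OrderTwo.{u}) i)
  have := hh a
  rwa [hZ, mul_right_comm, mul_inv_cancel, one_mul] at this

open RegularWreathProduct in
theorem exists_conj_eq (hφ : NaturalUpTo N φ) (hZ : φ OrderTwo.{u} = MonoidHom.id _) (G : Type u)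
    [Group G] [Finite G] : ∃ c ∈ N G, ∀ x, c * φ G x * c⁻¹ = x := by
  have : Nontrivial OrderTwo.{u} := ⟨_, _, OrderTwo.gen_ne_one⟩
  set b := base OrderTwo.{u} G
  obtain ⟨h, hN, hh⟩ := hφ.exists_conj b
  obtain ⟨l, lN, hl⟩ := hφ.exists_conj (rightHom : OrderTwo.{u} ≀ᵣ G →* G)
  simp only [hφ.apply_pi_eq hZ] at hh
  have hright : ∀ x, (h⁻¹ * φ _ (inl x) * h).right = x := by
    intro x
    refine right_eq_of_conj_base_eq fun a => ?_
    -- The base group is normal, so the conjugate of `b a` is again of the form `b a'`.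
    obtain ⟨a', ha'⟩ : ∃ a', b a' = inl x * b a * (inl x)⁻¹ :=
      ⟨fun t => a (x⁻¹ * t), by ext <;> simp [b, base]⟩
    have h1 := hh a'
    rw [ha', map_mul, map_mul, map_inv, ← hh a] at h1
    change _ * b a * _ = _ * b a * _
    calc _ = h⁻¹ * (φ _ (inl x) * (h * b a * h⁻¹) * (φ _ (inl x))⁻¹) * h := by
          simp only [mul_inv_rev, inv_inv, mul_assoc]
      _ = _ := by rw [← h1]; group
  refine ⟨(rightHom h)⁻¹ * l⁻¹, (N G).mul_mem ((N G).inv_mem (hφ.map_mem _ hN))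
    ((N G).inv_mem lN), fun x => ?_⟩
  have h1 : (rightHom h)⁻¹ * rightHom (φ (OrderTwo.{u} ≀ᵣ G) (inl x)) * rightHom h = x := by
    rw [← map_inv, ← map_mul, ← map_mul]
    exact hright x
  have h2 := hl (inl x)
  rw [fun_id] at h2
  rw [← h2]
  refine Eq.trans ?_ h1
  group

end NaturalUpTo

/-! ### Families of endomorphisms on the skeleton -/

namespace FinGrpSkel

/-- The object of the skeleton isomorphic to a given finite group. -/
abbrev ofGroup (G : Type u) [Group G] [Finite G] : FinGrpSkel.{u} := toSkeleton (FiniteGrp.of G)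

/-- The chosen isomorphism between a finite group and its representative in the skeleton. -/
noncomputable def ofGroupEquiv (G : Type u) [Group G] [Finite G] : (ofGroup G).grp ≃* G :=
  let e := fromSkeletonToSkeletonIso (FiniteGrp.of G)
  MonoidHom.toMulEquiv (N := G) (ConcreteCategory.hom e.hom) (ConcreteCategory.hom e.inv)
    (MonoidHom.ext fun x => ConcreteCategory.congr_hom e.hom_inv_id x)
    (MonoidHom.ext fun x => ConcreteCategory.congr_hom e.inv_hom_id x)

/-- The morphism of the skeleton with a given underlying homomorphism. -/
noncomputable def ofMonoidHom {X Y : FinGrpSkel.{u}} (f : X.grp →* Y.grp) : X ⟶ Y :=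
  (fromSkeleton FiniteGrp.{u}).preimage (ConcreteCategory.ofHom f)

@[simp]
theorem toMonoidHom_ofMonoidHom {X Y : FinGrpSkel.{u}} (f : X.grp →* Y.grp) :
    toMonoidHom (ofMonoidHom f) = f := by
  simp only [toMonoidHom, ofMonoidHom, Functor.map_preimage]
  rfl

theorem toMonoidHom_injective {X Y : FinGrpSkel.{u}} :
    Function.Injective (toMonoidHom : (X ⟶ Y) → (X.grp →* Y.grp)) := fun _ _ h =>
  (fromSkeleton FiniteGrp.{u}).map_injective (ConcreteCategory.hom_injective h)

@[simp]
theorem toMonoidHom_id (X : FinGrpSkel.{u}) : toMonoidHom (𝟙 X) = MonoidHom.id X.grp := rfl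

/-- On the skeleton, a family of endomorphisms that is natural up to conjugation is trivial or, up
to conjugation, the identity. -/
theorem eq_one_or_exists_conj_eq {N : ∀ (G : Type u) [Group G] [Finite G], Subgroup G}
    (hN : ∀ {G H : Type u} [Group G] [Finite G] [Group H] [Finite H] (f : G →* H) {x : G},
      x ∈ N G → f x ∈ N H)
    (φ : ∀ X : FinGrpSkel.{u}, X.grp →* X.grp)
    (hφ : ∀ {X Y : FinGrpSkel.{u}} (f : X.grp →* Y.grp),
      ∃ h ∈ N Y.grp, ∀ x, h * f (φ X x) * h⁻¹ = φ Y (f x)) :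
    (∀ X, φ X = 1) ∨ ∀ X, ∃ c ∈ N X.grp, ∀ x, c * φ X x * c⁻¹ = x := by
  let ψ (G : Type u) [Group G] [Finite G] : G →* G :=
    (ofGroupEquiv G).toMonoidHom.comp ((φ (ofGroup G)).comp (ofGroupEquiv G).symm.toMonoidHom)
  have hψ : NaturalUpTo N ψ := by
    refine ⟨hN, fun {G H} _ _ _ _ f => ?_⟩
    obtain ⟨h, hh, hf⟩ :=
      hφ ((ofGroupEquiv H).symm.toMonoidHom.comp (f.comp (ofGroupEquiv G).toMonoidHom))
    refine ⟨ofGroupEquiv H h, hN (ofGroupEquiv H).toMonoidHom hh, fun x => ?_⟩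
    have := congrArg (ofGroupEquiv H) (hf ((ofGroupEquiv G).symm x))
    simpa [ψ] using this
  have key (X : FinGrpSkel.{u}) : ∃ c ∈ N X.grp, ∀ x, c * φ X x * c⁻¹ = ψ X.grp x := by
    obtain ⟨h, hh, hf⟩ := hφ (ofGroupEquiv X.grp).symm.toMonoidHom
    refine ⟨ofGroupEquiv X.grp h, hN (ofGroupEquiv X.grp).toMonoidHom hh, fun x => ?_⟩
    simpa [ψ] using congrArg (ofGroupEquiv X.grp) (hf x)
  rcases OrderTwo.endo_eq_one_or_eq_id (ψ OrderTwo.{u}) with hZ | hZ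
  · refine Or.inl fun X => MonoidHom.ext fun x => ?_
    obtain ⟨c, -, hc⟩ := key X
    have := hc x
    rwa [hψ.eq_one hZ, MonoidHom.one_apply, conj_eq_one_iff] at this
  · refine Or.inr fun X => ?_
    obtain ⟨c, hcN, hc⟩ := key X
    obtain ⟨d, hdN, hd⟩ := hψ.exists_conj_eq hZ X.grp
    refine ⟨d * c, (N _).mul_mem hdN hcN, fun x => ?_⟩
    refine Eq.trans ?_ (hd x)
    rw [← hc x]
    group

/-! ### The two centers -/

/-- The central element of `B₀` given by the trivial endomorphisms. -/
noncomputable def zeroCenter : CatCenter FinGrpSkel.{u} where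
  app X := ofMonoidHom (1 : X.grp →* X.grp)
  naturality X Y f := toMonoidHom_injective <| by
    ext x
    simp [toMonoidHom_comp]

@[simp]
theorem toMonoidHom_zeroCenter_app (X : FinGrpSkel.{u}) :
    toMonoidHom (zeroCenter.app X) = 1 :=
  toMonoidHom_ofMonoidHom _

theorem zeroCenter_mul_self : zeroCenter.{u} * zeroCenter = zeroCenter := by
  ext X
  apply toMonoidHom_injective
  ext x
  simp [toMonoidHom_comp]

theorem catCenter_eq_zero_or_one (z : CatCenter FinGrpSkel.{u}) : z = zeroCenter ∨ z = 1 := by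
  rcases eq_one_or_exists_conj_eq (N := fun _ _ _ => ⊥)
    (fun f x hx => by rw [Subgroup.mem_bot] at hx ⊢; rw [hx, map_one])
    (fun X => toMonoidHom (z.app X)) (fun {X Y} f => ⟨1, Subgroup.one_mem _, fun x => by
      have := DFunLike.congr_fun (congrArg toMonoidHom (z.naturality (ofMonoidHom f))) x
      simpa [toMonoidHom_comp] using this.symm⟩) with h | h
  · left
    ext X
    apply toMonoidHom_injective
    rw [h X, toMonoidHom_zeroCenter_app]
  · right
    ext X
    apply toMonoidHom_injective
    ext x
    obtain ⟨c, hc, hx⟩ := h X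
    rw [Subgroup.mem_bot.mp hc] at hx
    simpa using hx x

end FinGrpSkel

namespace HoFinGrp

open FinGrpSkel

/-- The image of `FinGrpSkel.zeroCenter` in the homotopy category. -/
noncomputable def zeroCenter : CatCenter HoFinGrp.{u} :=
  Quotient.natTransLift homotopyRel.{u}
    (Functor.whiskerRight FinGrpSkel.zeroCenter.{u} (Quotient.functor homotopyRel.{u}))

theorem zeroCenter_app (X : FinGrpSkel.{u}) :
    zeroCenter.app ((Quotient.functor homotopyRel.{u}).obj X) =
      (Quotient.functor homotopyRel.{u}).map (FinGrpSkel.zeroCenter.app X) := rfl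

theorem catCenter_ext {z w : CatCenter HoFinGrp.{u}}
    (h : ∀ X, z.app ((Quotient.functor homotopyRel.{u}).obj X) =
      w.app ((Quotient.functor homotopyRel.{u}).obj X)) : z = w :=
  CatCenter.ext _ _ fun X => h X.as

theorem zeroCenter_mul_self : zeroCenter.{u} * zeroCenter = zeroCenter := by
  refine catCenter_ext fun X => ?_
  rw [CatCenter.mul_app, zeroCenter_app, ← Functor.map_comp, ← CatCenter.mul_app,
    FinGrpSkel.zeroCenter_mul_self]

theorem zeroCenter_ne_one : zeroCenter.{u} ≠ 1 := by
  intro h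
  have h1 : (Quotient.functor homotopyRel.{u}).map
      (FinGrpSkel.zeroCenter.app (ofGroup OrderTwo.{u})) =
      (Quotient.functor homotopyRel.{u}).map (𝟙 _) := by
    rw [← zeroCenter_app, h, CategoryTheory.Functor.map_id]
    rfl
  obtain ⟨c, hc⟩ := (Quotient.functor_map_eq_iff _ _ _).mp h1
  have h2 := hc ((ofGroupEquiv _).symm OrderTwo.gen)
  simp at h2
  exact OrderTwo.gen_ne_one ((map_eq_one_iff _ (ofGroupEquiv _).symm.injective).mp h2.symm)

theorem catCenter_eq_zero_or_one (z : CatCenter HoFinGrp.{u}) : z = zeroCenter ∨ z = 1 := by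
  choose r hr using fun X : FinGrpSkel.{u} =>
    (Quotient.functor homotopyRel.{u}).map_surjective
      (z.app ((Quotient.functor homotopyRel.{u}).obj X))
  rcases eq_one_or_exists_conj_eq (N := fun _ _ _ => ⊤) (fun _ _ _ => Subgroup.mem_top _)
    (fun X => toMonoidHom (r X)) (fun {X Y} f => by
      have h := z.naturality ((Quotient.functor homotopyRel.{u}).map (ofMonoidHom f))
      rw [← hr, ← hr, ← Functor.map_comp, ← Functor.map_comp] at h
      obtain ⟨c, hc⟩ := (Quotient.functor_map_eq_iff _ _ _).mp h.symm
      exact ⟨c, Subgroup.mem_top _, fun x => by simpa [toMonoidHom_comp] using hc x⟩) with h | h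
  · left
    refine catCenter_ext fun X => ?_
    rw [zeroCenter_app, ← hr]
    congr 1
    apply toMonoidHom_injective
    rw [h X, toMonoidHom_zeroCenter_app]
  · right
    refine catCenter_ext fun X => ?_
    obtain ⟨c, -, hc⟩ := h X
    rw [← hr]
    exact CategoryTheory.Quotient.sound _ ⟨⟨c, hc⟩⟩

end HoFinGrp

theorem FinGrpSkel.zeroCenter_ne_one : FinGrpSkel.zeroCenter.{u} ≠ 1 := by
  intro h
  refine HoFinGrp.zeroCenter_ne_one.{u} (HoFinGrp.catCenter_ext fun X => ?_)
  rw [HoFinGrp.zeroCenter_app, h]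
  exact CategoryTheory.Functor.map_id _ _

/-- A monoid consisting of `1` and one further idempotent is isomorphic to `{0, 1}`. -/
theorem nonempty_mulEquiv_zeroOne {M : Type*} [Monoid M] {z : M} (hz : z * z = z) (hz1 : z ≠ 1)
    (h : ∀ m, m = z ∨ m = 1) : Nonempty (M ≃* ZeroOne) := by
  classical
  let f : M →* ZeroOne :=
    { toFun m := if m = 1 then 1 else ⟨0, Or.inl rfl⟩
      map_one' := if_pos rfl
      map_mul' a b := by
        rcases h a with rfl | rfl <;> rcases h b with rfl | rfl <;> simp [hz, hz1, Subtype.ext_iff] }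
  refine ⟨MulEquiv.ofBijective f ⟨fun a b hab => ?_, ?_⟩⟩
  · rcases h a with rfl | rfl <;> rcases h b with rfl | rfl <;>
      simp_all [f, Subtype.ext_iff]
  · rintro ⟨n, rfl | rfl⟩
    · exact ⟨z, if_neg hz1⟩
    · exact ⟨1, map_one f⟩

theorem proposition8p1 :
    Nonempty (CatCenter FinGrpSkel.{u} ≃* ZeroOne) ∧
      Nonempty (CatCenter HoFinGrp.{u} ≃* ZeroOne) :=
  ⟨nonempty_mulEquiv_zeroOne FinGrpSkel.zeroCenter_mul_self FinGrpSkel.zeroCenter_ne_one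
      FinGrpSkel.catCenter_eq_zero_or_one,
    nonempty_mulEquiv_zeroOne HoFinGrp.zeroCenter_mul_self HoFinGrp.zeroCenter_ne_one
      HoFinGrp.catCenter_eq_zero_or_one⟩
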